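/- All rings are commutative and unital. For a ring extension $A\subseteq B$, let $[A,B]$ denote the set of $A$-subalgebras of $B$. The extension $A\subseteq B$ is called Prüfer if $A\subseteq T$ is a flat epimorphism of commutative rings for every $T\in[A,B]$, and quasi-Prüfer if $\overline{A}^{B}\subseteq B$ is Prüfer, where $\overline{A}^{B}$ is the integral closure of $A$ in $B$. The Prüfer hull $\widetilde{A}^{B}$ of $A$ in $B$ is the greatest $T\in[A,B]$ such that $A\subseteq T$ is Prüfer. Theorem. Let $R\subseteq S$ be a ring extension, and put $\overline R:=\overline R^{S}$. Prüfer hulls exist (in particular those of $R$ in $S$, of $\overline R$ in $S$, and of $R$ in the ring $R^{*}$ below); put $\widetilde R:=\widetilde R^{S}$. 1. There is a greatest $R^{*}\in[R,S]$ such that $R\subseteq R^{*}$ is quasi-Prüfer, and $R^{*}=\widetilde{\overline R}^{S}$, the Prüfer hull of $\overline R$ in $S$. 2. Let $\overline R\,\widetilde R$ be the $R$-subalgebra of $S$ generated by $\overline R\cup\widetilde R$. Then $R\subseteq\overline R\,\widetilde R$ is quasi-Prüfer, and hence $\overline R\,\widetilde R\subseteq R^{*}$. 3. $\overline R^{R^{*}}=\overline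 R$ and $\widetilde R^{R^{*}}=\widetilde R$. -/

import Mathlib

/-- `A → B` is a flat epimorphism of commutative rings. -/
def IsFlatEpimorphism (A B : Type*) [CommRing A] [CommRing B] [Algebra A B] : Prop :=
  Module.Flat A B ∧ Algebra.IsEpi A B

/-- A ring extension `A ⊆ B` is Prüfer if `A ⊆ T` is a flat epimorphism for every
intermediate ring `T` of `A ⊆ B`. -/
def IsPruferExtension (A B : Type*) [CommRing A] [CommRing B] [Algebra A B] : Prop :=
  Function.Injective (algebraMap A B) ∧ ∀ T : Subalgebra A B, IsFlatEpimorphism A T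

/-- A ring extension `A ⊆ B` is quasi-Prüfer if `B` is a Prüfer extension of the integral
closure of `A` in `B`. -/
def IsQuasiPruferExtension (A B : Type*) [CommRing A] [CommRing B] [Algebra A B] : Prop :=
  Function.Injective (algebraMap A B) ∧ IsPruferExtension (integralClosure A B) B

/-- The Prüfer hull of `A` in `B`: the supremum of the intermediate rings `T` such that `A ⊆ T`
is Prüfer. The main theorem includes the fact that it is the greatest one. -/
noncomputable def pruferHull (A B : Type*) [CommRing A] [CommRing B] [Algebra A B] :
    Subalgebra A B :=
  sSup {T : Subalgebra A B | IsPruferExtension A T}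

/-- The supremum of the intermediate rings `T` of `A ⊆ B` such that `A ⊆ T` is quasi-Prüfer.
The main theorem includes the fact that it is the greatest one. -/
noncomputable def quasiPruferHull (A B : Type*) [CommRing A] [CommRing B] [Algebra A B] :
    Subalgebra A B :=
  sSup {T : Subalgebra A B | IsQuasiPruferExtension A T}

open Polynomial

/-! Everything rests on an elementwise criterion (`isPruferExtension_iff`): an extension of `A` is
Prüfer iff each element `x` satisfies `(A : x) + x (A : x) = A`. This condition does not depend on
the ambient ring and persists when the base grows. Hulls exist because, at a prime of `A`, Prüfer
subextensions form a chain (`le_saturationAt_or_le_saturationAt`), so the criterion passes to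
suprema. The maximality of the hull of the integral closure `C` rests on
`isPruferElement_of_isIntegral`: if `T` is quasi-Prüfer, an integral equation over `T` can be scaled
to a polynomial over `C` with a coefficient outside a given prime, and as `C` is integrally closed
this forces the criterion there. -/

/-- The ideal of all `a` in `A` such that `a * x` lies in the image of `A`. -/
def denominatorIdeal (A : Type*) {B : Type*} [CommRing A] [CommRing B] [Algebra A B] (x : B) :
    Ideal A where
  carrier := {a | algebraMap A B a * x ∈ (algebraMap A B).range}
  add_mem' := by
    rintro a b ⟨a', ha⟩ ⟨b', hb⟩
    exact ⟨a' + b', by simp [add_mul, ha, hb]⟩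
  zero_mem' := ⟨0, by simp⟩
  smul_mem' := by
    rintro c a ⟨a', ha⟩
    exact ⟨c * a', by simp [mul_assoc, ha]⟩

/-- The ideal `(A : x) + x (A : x)` of `A`, where `(A : x)` is the denominator ideal of `x`. -/
def pruferIdeal (A : Type*) {B : Type*} [CommRing A] [CommRing B] [Algebra A B] (x : B) :
    Ideal A where
  carrier := {r | ∃ u ∈ denominatorIdeal A x, ∃ v b : A,
    algebraMap A B v * x = algebraMap A B b ∧ u + b = r}
  add_mem' := by
    rintro _ _ ⟨u, hu, v, b, hb, rfl⟩ ⟨u', hu', v', b', hb', rfl⟩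
    exact ⟨u + u', add_mem hu hu', v + v', b + b', by simp [add_mul, hb, hb'], by ring⟩
  zero_mem' := ⟨0, zero_mem _, 0, 0, by simp, by simp⟩
  smul_mem' := by
    rintro c _ ⟨u, hu, v, b, hb, rfl⟩
    exact ⟨c * u, Ideal.mul_mem_left _ _ hu, c * v, c * b, by simp [mul_assoc, hb],
      by simp [mul_add]⟩

/-- The condition `(A : x) + x (A : x) = A`: locally on `A`, either `x` lies in `A` or `x` is
invertible with inverse in `A`. -/
def IsPruferElement (A : Type*) {B : Type*} [CommRing A] [CommRing B] [Algebra A B] (x : B) :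
    Prop :=
  ∃ u v a b : A, algebraMap A B u * x = algebraMap A B a ∧
    algebraMap A B v * x = algebraMap A B b ∧ u + b = 1

/-! ### Prüfer elements and change of rings -/

section

variable {A B : Type*} [CommRing A] [CommRing B] [Algebra A B]

theorem mem_denominatorIdeal {x : B} {a : A} :
    a ∈ denominatorIdeal A x ↔ ∃ b, algebraMap A B b = algebraMap A B a * x := Iff.rfl

theorem mem_pruferIdeal {x : B} {r : A} :
    r ∈ pruferIdeal A x ↔ ∃ u ∈ denominatorIdeal A x, ∃ v b : A,
      algebraMap A B v * x = algebraMap A B b ∧ u + b = r := Iff.rfl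

theorem denominatorIdeal_le_pruferIdeal (x : B) :
    denominatorIdeal A x ≤ pruferIdeal A x :=
  fun u hu ↦ ⟨u, hu, 0, 0, by simp, by simp⟩

theorem mem_pruferIdeal_of_mul_eq {x : B} {v b : A}
    (h : algebraMap A B v * x = algebraMap A B b) : b ∈ pruferIdeal A x :=
  ⟨0, zero_mem _, v, b, h, by simp⟩

theorem isPruferElement_iff_pruferIdeal_eq_top {x : B} :
    IsPruferElement A x ↔ pruferIdeal A x = ⊤ := by
  rw [Ideal.eq_top_iff_one, mem_pruferIdeal]
  constructor
  · rintro ⟨u, v, a, b, h1, h2, h3⟩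
    exact ⟨u, ⟨a, h1.symm⟩, v, b, h2, h3⟩
  · rintro ⟨u, ⟨a, h1⟩, v, b, h2, h3⟩
    exact ⟨u, v, a, b, h1.symm, h2, h3⟩

theorem isPruferElement_of_forall_prime {x : B}
    (h : ∀ m : Ideal A, m.IsPrime → ¬ pruferIdeal A x ≤ m) : IsPruferElement A x := by
  rw [isPruferElement_iff_pruferIdeal_eq_top]
  by_contra hx
  obtain ⟨m, hm, hle⟩ := Ideal.exists_le_maximal _ hx
  exact h m hm.isPrime hle

theorem isPruferElement_algebraMap (a : A) : IsPruferElement A (algebraMap A B a) :=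
  ⟨1, 0, a, 0, by simp, by simp, by simp⟩

/-- Prüfer elements are preserved by compatible ring homomorphisms. -/
theorem IsPruferElement.map {A' B' : Type*} [CommRing A'] [CommRing B'] [Algebra A' B']
    (φ : A →+* A') (ψ : B →+* B') (hφψ : ∀ a, ψ (algebraMap A B a) = algebraMap A' B' (φ a))
    {x : B} (hx : IsPruferElement A x) : IsPruferElement A' (ψ x) := by
  obtain ⟨u, v, a, b, h1, h2, h3⟩ := hx
  refine ⟨φ u, φ v, φ a, φ b, ?_, ?_, ?_⟩
  · rw [← hφψ, ← hφψ, ← map_mul, h1]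
  · rw [← hφψ, ← hφψ, ← map_mul, h2]
  · rw [← map_add, h3, map_one]

theorem IsPruferElement.of_map {A' B' : Type*} [CommRing A'] [CommRing B'] [Algebra A' B']
    (φ : A →+* A') (ψ : B →+* B') (hφψ : ∀ a, ψ (algebraMap A B a) = algebraMap A' B' (φ a))
    (hφ : Function.Bijective φ) (hψ : Function.Injective ψ)
    {x : B} (hx : IsPruferElement A' (ψ x)) : IsPruferElement A x := by
  obtain ⟨u, v, a, b, h1, h2, h3⟩ := hx
  obtain ⟨u, rfl⟩ := hφ.2 u
  obtain ⟨v, rfl⟩ := hφ.2 v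
  obtain ⟨a, rfl⟩ := hφ.2 a
  obtain ⟨b, rfl⟩ := hφ.2 b
  refine ⟨u, v, a, b, hψ ?_, hψ ?_, hφ.1 ?_⟩
  · rw [map_mul, hφψ, hφψ, h1]
  · rw [map_mul, hφψ, hφψ, h2]
  · rw [map_add, h3, map_one]

theorem isPruferElement_algHom_iff {B' : Type*} [CommRing B'] [Algebra A B'] (ψ : B →ₐ[A] B')
    (hψ : Function.Injective ψ) {x : B} : IsPruferElement A (ψ x) ↔ IsPruferElement A x :=
  ⟨fun h ↦ .of_map (RingHom.id A) ψ.toRingHom (fun a ↦ ψ.commutes a) Function.bijective_id hψ h,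
    fun h ↦ h.map (RingHom.id A) ψ.toRingHom (fun a ↦ ψ.commutes a)⟩

/-- If `f • x` satisfies the Prüfer condition, then `f` lies in the Prüfer ideal
of `x`. -/
theorem IsPruferElement.mem_pruferIdeal_of_smul {f : A} {x : B}
    (h : IsPruferElement A (algebraMap A B f * x)) : f ∈ pruferIdeal A x := by
  obtain ⟨u, v, a, b, h1, h2, h3⟩ := h
  have hu : u * f ∈ pruferIdeal A x := denominatorIdeal_le_pruferIdeal x
    ⟨a, by rw [← h1, map_mul, mul_assoc]⟩
  have hb : b ∈ pruferIdeal A x := mem_pruferIdeal_of_mul_eq (v := v * f)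
    (by rw [← h2, map_mul, mul_assoc])
  have := add_mem hu (Ideal.mul_mem_left _ f hb)
  rwa [show u * f + f * b = f by rw [mul_comm u, ← mul_add, h3, mul_one]] at this

/-! ### The elementwise criterion for Prüfer extensions -/

/-- An element that is a root of a polynomial with a coefficient outside a prime `m` satisfies the
Prüfer condition at `m`, provided that the base ring is integrally closed. -/
theorem not_pruferIdeal_le_of_aeval_eq_zero (hinj : Function.Injective (algebraMap A B))
    (hA : ∀ y : B, IsIntegral A y → y ∈ (algebraMap A B).range) (m : Ideal A) {x : B} :
    ∀ (n : ℕ) (f : A[X]), f.natDegree ≤ n → aeval x f = 0 → ∀ i, f.coeff i ∉ m →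
      ¬ pruferIdeal A x ≤ m := by
  intro n
  induction n with
  | zero =>
    intro f hf hx i hi
    rw [eq_C_of_natDegree_le_zero hf, aeval_C, map_eq_zero_iff _ hinj] at hx
    rw [eq_C_of_natDegree_le_zero hf, hx] at hi
    simp at hi
  | succ n ih =>
    intro f hf hx i hi hle
    by_cases hfn : f.natDegree ≤ n
    · exact ih f hfn hx i hi hle
    have hdeg : f.natDegree = n + 1 := by omega
    -- With leading coefficient `l`, integral closedness gives `l * x = a` in `A`, so the top term
    -- becomes `a * x ^ n`. Since `l` and `a` lie in `m`, some coefficient stays outside `m`.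
    obtain ⟨a, ha⟩ := hA _ (isIntegral_leadingCoeff_smul f x hx)
    rw [Algebra.smul_def] at ha
    have hl : f.leadingCoeff ∈ m := hle (denominatorIdeal_le_pruferIdeal x ⟨a, ha⟩)
    have ham : a ∈ m := hle (mem_pruferIdeal_of_mul_eq ha.symm)
    refine ih (f.eraseLead + C a * X ^ n) ?_ ?_ i ?_ hle
    · have := f.eraseLead_natDegree_le
      suffices f.eraseLead.natDegree ≤ n by compute_degree!
      omega
    · have h0 := hx
      rw [← f.eraseLead_add_C_mul_X_pow, hdeg] at h0
      simp only [map_add, map_mul, aeval_C, map_pow, aeval_X] at h0 ⊢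
      rw [ha, ← h0]
      ring
    · have hin : i ≠ n + 1 := by
        rintro rfl
        exact hi (by rw [← hdeg]; exact hl)
      rw [coeff_add, eraseLead_coeff_of_ne i (by omega), coeff_C_mul, coeff_X_pow]
      split_ifs
      · rwa [mul_one, Ideal.add_mem_iff_left _ ham]
      · simpa using hi

/-- Epimorphy gives `1 ⊗ x = x ⊗ 1`; flatness makes this relation trivial, which writes `1` as a
combination of denominators of `x`. -/
theorem IsFlatEpimorphism.map_denominatorIdeal (h : IsFlatEpimorphism A B) (x : B) :
    (denominatorIdeal A x).map (algebraMap A B) = ⊤ := by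
  obtain ⟨hflat, hepi⟩ := h
  have hx := (Algebra.isEpi_iff_forall_one_tmul_eq A B).mp hepi x
  have hsum : ∑ i, (![1, -x] : Fin 2 → B) i ⊗ₜ[A] (![x, 1] : Fin 2 → B) i = 0 := by
    simp [Fin.sum_univ_two, TensorProduct.neg_tmul, hx]
  obtain ⟨k, a, y, h1, h2⟩ :=
    TensorProduct.vanishesTrivially_of_sum_tmul_eq_zero_of_rTensor_injective A
      (Module.Flat.rTensor_preserves_injective_linearMap _ (Submodule.injective_subtype _)) hsum
  rw [Ideal.eq_top_iff_one]
  have h1' : 1 = ∑ j, a 1 j • y j := h1 1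
  rw [h1']
  refine sum_mem fun j _ ↦ ?_
  rw [Algebra.smul_def]
  refine Ideal.mul_mem_right _ _ (Ideal.mem_map_of_mem _ ⟨a 0 j, ?_⟩)
  have := h2 j
  simp [Fin.sum_univ_two, Algebra.smul_def] at this
  linear_combination this

/-- Denominators of `x` generate the unit ideal of `A[x]`. For integral `x` this descends to `A` by
integrality, so `A` is integrally closed. In general it gives `p(x) = 1` with denominators as
coefficients, and `1 - p` has constant term outside any prime containing them. -/
theorem IsPruferExtension.isPruferElement (h : IsPruferExtension A B) (x : B) :
    IsPruferElement A x := by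
  obtain ⟨hinj, h⟩ := h
  have key (x : B) : (denominatorIdeal A x).map (algebraMap A (Algebra.adjoin A {x})) = ⊤ := by
    rw [← (h (Algebra.adjoin A {x})).map_denominatorIdeal
      ⟨x, Algebra.self_mem_adjoin_singleton A x⟩]
    congr 1
    ext a
    simp only [mem_denominatorIdeal, Subtype.ext_iff]
    rfl
  have hinj' (x : B) : Function.Injective (algebraMap A (Algebra.adjoin A {x})) :=
    fun a b hab ↦ hinj (congrArg Subtype.val hab)
  have hA (y : B) (hy : IsIntegral A y) : y ∈ (algebraMap A B).range := by
    have hint : (algebraMap A (Algebra.adjoin A {y})).IsIntegral := by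
      have := Algebra.IsIntegral.adjoin (R := A) (S := {y}) (by simpa using hy)
      exact this.1
    have h1 := key y
    rw [Ideal.map_eq_top_iff _ (hinj' y) hint, Ideal.eq_top_iff_one] at h1
    simpa [mem_denominatorIdeal] using h1
  refine isPruferElement_of_forall_prime fun m hm hle ↦ ?_
  have hle' : denominatorIdeal A x ≤ m := (denominatorIdeal_le_pruferIdeal x).trans hle
  let φ : A[X] →ₐ[A] Algebra.adjoin A {x} := aeval ⟨x, Algebra.self_mem_adjoin_singleton A x⟩
  have hφ : Function.Surjective φ := by
    rintro ⟨z, hz⟩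
    obtain ⟨p, rfl⟩ := Algebra.adjoin_singleton_eq_range_aeval A x ▸ hz
    refine ⟨p, Subtype.ext ?_⟩
    exact (aeval_algHom_apply (Algebra.adjoin A {x}).val _ p).symm
  have h1 := key x
  rw [show algebraMap A (Algebra.adjoin A {x}) = φ.toRingHom.comp C from
    (φ.comp_algebraMap).symm, ← Ideal.map_map, Ideal.eq_top_iff_one,
    Ideal.mem_map_iff_of_surjective φ.toRingHom hφ] at h1
  obtain ⟨p, hp, hp1⟩ := h1
  rw [Ideal.mem_map_C_iff] at hp
  refine not_pruferIdeal_le_of_aeval_eq_zero hinj hA m _ (1 - p) le_rfl ?_ 0 ?_ hle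
  · have : aeval x p = 1 := by
      have := congrArg (Algebra.adjoin A {x}).val hp1
      rw [map_one] at this
      rw [← this]
      exact aeval_algHom_apply (Algebra.adjoin A {x}).val
        ⟨x, Algebra.self_mem_adjoin_singleton A x⟩ p
    simp [this]
  · intro h0
    rw [coeff_sub, coeff_one_zero] at h0
    exact hm.ne_top ((Ideal.eq_top_iff_one _).2
      (by simpa using add_mem h0 (hle' (hp 0))))

/-- Here `x = a + b x` and `b = v x`, so `b x` crosses the tensor sign through `v x ⊗ x = x ⊗ v x`.
-/
theorem isEpi_of_forall_isPruferElement (h : ∀ x : B, IsPruferElement A x) :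
    Algebra.IsEpi A B := by
  rw [Algebra.isEpi_iff_forall_one_tmul_eq]
  intro x
  obtain ⟨u, v, a, b, h1, h2, h3⟩ := h x
  have e1 : x = algebraMap A B a + b • x := by
    rw [← h1, Algebra.smul_def, ← add_mul, ← map_add, h3, map_one, one_mul]
  have e2 : (1 : B) ⊗ₜ[A] (b • x) = (b • x) ⊗ₜ[A] (1 : B) := by
    calc (1 : B) ⊗ₜ[A] (b • x) = (b • (1 : B)) ⊗ₜ[A] x := by
          rw [TensorProduct.smul_tmul]
      _ = (v • x) ⊗ₜ[A] x := by rw [Algebra.smul_def, Algebra.smul_def, h2, mul_one]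
      _ = x ⊗ₜ[A] (b • (1 : B)) := by
          rw [TensorProduct.smul_tmul, Algebra.smul_def, Algebra.smul_def, h2, mul_one]
      _ = (b • x) ⊗ₜ[A] (1 : B) := by rw [TensorProduct.smul_tmul]
  have e3 : (1 : B) ⊗ₜ[A] (algebraMap A B a) = (algebraMap A B a) ⊗ₜ[A] (1 : B) := by
    rw [Algebra.algebraMap_eq_smul_one, TensorProduct.smul_tmul]
  calc (1 : B) ⊗ₜ[A] x = (1 : B) ⊗ₜ[A] (algebraMap A B a + b • x) := by rw [← e1]
    _ = (algebraMap A B a + b • x) ⊗ₜ[A] (1 : B) := by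
      rw [TensorProduct.tmul_add, TensorProduct.add_tmul, e2, e3]
    _ = x ⊗ₜ[A] (1 : B) := by rw [← e1]

/-- Common denominators of the `x i` generate the unit ideal of `B`; multiplying a relation by them
turns it into relations over `A`. -/
theorem flat_of_forall_isPruferElement (hinj : Function.Injective (algebraMap A B))
    (h : ∀ x : B, IsPruferElement A x) : Module.Flat A B := by
  rw [Module.Flat.iff_forall_isTrivialRelation]
  intro l f x hfx
  have htop : (⨅ i, denominatorIdeal A (x i)).map (algebraMap A B) = ⊤ := by
    by_contra hne
    obtain ⟨M, hM, hle⟩ := Ideal.exists_le_maximal _ hne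
    have hc (i : Fin l) : ∃ c ∈ denominatorIdeal A (x i), algebraMap A B c ∉ M := by
      by_contra! hcon
      obtain ⟨u, v, a, b, h1, h2, h3⟩ := h (x i)
      have hu := hcon u ⟨a, h1.symm⟩
      have hv := hcon v ⟨b, h2.symm⟩
      refine hM.ne_top ((Ideal.eq_top_iff_one _).2 ?_)
      rw [← map_one (algebraMap A B), ← h3, map_add, ← h2]
      exact add_mem hu (Ideal.mul_mem_right _ _ hv)
    choose c hc hcM using hc
    have hprod : algebraMap A B (∏ i, c i) ∈ M := hle <| Ideal.mem_map_of_mem _ <|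
      (Submodule.mem_iInf _).2 fun i ↦
        Ideal.mem_of_dvd _ (Finset.dvd_prod_of_mem c (Finset.mem_univ i)) (hc i)
    rw [map_prod] at hprod
    obtain ⟨i, -, hi⟩ := (hM.isPrime.prod_mem_iff).1 hprod
    exact hcM i hi
  rw [Ideal.eq_top_iff_one, Ideal.map, Ideal.span, Submodule.mem_span_set'] at htop
  obtain ⟨k, y, g, hg⟩ := htop
  have hg' (j : Fin k) : ∃ c ∈ ⨅ i, denominatorIdeal A (x i), algebraMap A B c = g j := (g j).2
  choose c hc hcg using hg'
  have hc' (i : Fin l) (j : Fin k) : ∃ b, algebraMap A B b = algebraMap A B (c j) * x i :=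
    (Submodule.mem_iInf _).1 (hc j) i
  choose b hb using hc'
  refine ⟨k, b, y, fun i ↦ ?_, fun j ↦ hinj ?_⟩
  · calc x i = x i * ∑ j, y j • (g j : B) := by rw [hg, mul_one]
      _ = ∑ j, b i j • y j := by
        rw [Finset.mul_sum]
        refine Finset.sum_congr rfl fun j _ ↦ ?_
        rw [Algebra.smul_def (b i j), hb, hcg, smul_eq_mul]
        ring
  · simp only [Algebra.smul_def] at hfx
    rw [map_sum, map_zero, ← mul_zero (algebraMap A B (c j)), ← hfx, Finset.mul_sum]
    refine Finset.sum_congr rfl fun i _ ↦ ?_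
    rw [map_mul, hb]
    ring

theorem isPruferExtension_iff (hinj : Function.Injective (algebraMap A B)) :
    IsPruferExtension A B ↔ ∀ x : B, IsPruferElement A x := by
  refine ⟨fun h ↦ h.isPruferElement, fun h ↦ ⟨hinj, fun T ↦ ?_⟩⟩
  have hT (x : T) : IsPruferElement A x :=
    (isPruferElement_algHom_iff T.val Subtype.val_injective).1 (h x)
  exact ⟨flat_of_forall_isPruferElement (fun a b hab ↦ hinj (congrArg Subtype.val hab)) hT,
    isEpi_of_forall_isPruferElement hT⟩

end

/-! ### Local comparison of subextensions and existence of hulls -/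

section

variable {A S : Type*} [CommRing A] [CommRing S] [Algebra A S]

/-- The elements of `S` that lie in `T` locally at the prime ideal `m` of `A`. -/
def Subalgebra.saturationAt (T : Subalgebra A S) (m : Ideal A) [m.IsPrime] : Subalgebra A S where
  carrier := {z | ∃ f ∉ m, algebraMap A S f * z ∈ T}
  mul_mem' := by
    rintro y z ⟨f, hf, hy⟩ ⟨g, hg, hz⟩
    refine ⟨f * g, fun h ↦ (Ideal.IsPrime.mem_or_mem ‹_› h).elim hf hg, ?_⟩
    rw [map_mul, mul_mul_mul_comm]
    exact mul_mem hy hz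
  add_mem' := by
    rintro y z ⟨f, hf, hy⟩ ⟨g, hg, hz⟩
    refine ⟨f * g, fun h ↦ (Ideal.IsPrime.mem_or_mem ‹_› h).elim hf hg, ?_⟩
    rw [map_mul, show algebraMap A S f * algebraMap A S g * (y + z) =
      algebraMap A S g * (algebraMap A S f * y) + algebraMap A S f * (algebraMap A S g * z) by ring]
    exact add_mem (mul_mem (T.algebraMap_mem g) hy) (mul_mem (T.algebraMap_mem f) hz)
  algebraMap_mem' r := ⟨1, fun h ↦ Ideal.IsPrime.ne_top ‹_› ((Ideal.eq_top_iff_one _).2 h),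
    by simp⟩

theorem Subalgebra.le_saturationAt (T : Subalgebra A S) (m : Ideal A) [m.IsPrime] :
    T ≤ T.saturationAt m :=
  fun z hz ↦ ⟨1, fun h ↦ Ideal.IsPrime.ne_top ‹_› ((Ideal.eq_top_iff_one _).2 h), by simpa using hz⟩

theorem Subalgebra.saturationAt_le_of_le {T T' : Subalgebra A S} {m : Ideal A} [m.IsPrime]
    (h : T ≤ T'.saturationAt m) : T.saturationAt m ≤ T'.saturationAt m := by
  rintro z ⟨f, hf, hz⟩
  obtain ⟨g, hg, hz'⟩ := h hz
  exact ⟨g * f, fun h ↦ (Ideal.IsPrime.mem_or_mem ‹_› h).elim hg hf,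
    by rwa [map_mul, mul_assoc]⟩

/-- Locally at a prime ideal, Prüfer subextensions are totally ordered. -/
theorem le_saturationAt_or_le_saturationAt {T T' : Subalgebra A S}
    (hT : ∀ x ∈ T, IsPruferElement A x) (hT' : ∀ y ∈ T', IsPruferElement A y)
    (m : Ideal A) [m.IsPrime] : T ≤ T'.saturationAt m ∨ T' ≤ T.saturationAt m := by
  by_contra! hcon
  obtain ⟨x, hx, hxT⟩ := SetLike.not_le_iff_exists.1 hcon.1
  obtain ⟨y, hy, hyT⟩ := SetLike.not_le_iff_exists.1 hcon.2
  have hF (f : A) (hf : algebraMap A S f * x ∈ T') : f ∈ m := by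
    by_contra h
    exact hxT ⟨f, h, hf⟩
  have hG (f : A) (hf : algebraMap A S f * y ∈ T) : f ∈ m := by
    by_contra h
    exact hyT ⟨f, h, hf⟩
  obtain ⟨u, v, a, s, h1, h2, h3⟩ := hT x hx
  -- At `m`, `v` is `x⁻¹` up to the unit `s`, so this tests `y / x`: if it lies in `A` then `y` is
  -- in `T`, and if its inverse does then `x` is in `T'`.
  obtain ⟨c, d, b, e, h4, h5, h6⟩ := hT' (algebraMap A S v * y) (mul_mem (T'.algebraMap_mem v) hy)
  have hu : u ∈ m := hF u (h1 ▸ T'.algebraMap_mem a)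
  have hs : s ∉ m := fun hs ↦ Ideal.IsPrime.ne_top ‹_›
    ((Ideal.eq_top_iff_one _).2 (h3 ▸ add_mem hu hs))
  have hc : c * s ∈ m := by
    refine hG _ ?_
    rw [map_mul, ← h2, show algebraMap A S c * (algebraMap A S v * x) * y =
      x * (algebraMap A S c * (algebraMap A S v * y)) by ring, h4]
    exact mul_mem hx (T.algebraMap_mem b)
  have he : e ∈ m := by
    refine hF _ ?_
    rw [← h5, show algebraMap A S d * (algebraMap A S v * y) * x =
      algebraMap A S d * (algebraMap A S v * x) * y by ring, h2]
    exact mul_mem (mul_mem (T'.algebraMap_mem d) (T'.algebraMap_mem s)) hy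
  exact Ideal.IsPrime.ne_top ‹_› ((Ideal.eq_top_iff_one _).2
    (h6 ▸ add_mem ((Ideal.IsPrime.mem_or_mem ‹_› hc).resolve_right hs) he))

/-- At each prime the saturations are directed, so a multiple `f * x` with `f` outside the prime
lies in a single `T`. -/
theorem isPruferElement_of_mem_sSup {𝒯 : Set (Subalgebra A S)}
    (h𝒯 : ∀ T ∈ 𝒯, ∀ x ∈ T, IsPruferElement A x) {x : S} (hx : x ∈ sSup 𝒯) :
    IsPruferElement A x := by
  obtain rfl | ⟨T₀, hT₀⟩ := 𝒯.eq_empty_or_nonempty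
  · rw [sSup_empty] at hx
    obtain ⟨a, rfl⟩ := Algebra.mem_bot.1 hx
    exact isPruferElement_algebraMap a
  refine isPruferElement_of_forall_prime fun m hm hle ↦ ?_
  have hdir (T T' : 𝒯) : ∃ U : 𝒯, T.1.saturationAt m ≤ U.1.saturationAt m ∧
      T'.1.saturationAt m ≤ U.1.saturationAt m := by
    obtain h | h := le_saturationAt_or_le_saturationAt (h𝒯 T T.2) (h𝒯 T' T'.2) m
    · exact ⟨T', Subalgebra.saturationAt_le_of_le h, le_rfl⟩
    · exact ⟨T, le_rfl, Subalgebra.saturationAt_le_of_le h⟩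
  have : Nonempty 𝒯 := ⟨⟨T₀, hT₀⟩⟩
  have hsup : sSup 𝒯 ≤ ⨆ T : 𝒯, T.1.saturationAt m :=
    sSup_le fun T hT ↦ (T.le_saturationAt m).trans
      (le_iSup (fun T : 𝒯 ↦ T.1.saturationAt m) ⟨T, hT⟩)
  have hx' := hsup hx
  rw [← SetLike.mem_coe, Subalgebra.coe_iSup_of_directed hdir, Set.mem_iUnion] at hx'
  obtain ⟨T, f, hf, hfx⟩ := hx'
  exact hf (hle (h𝒯 T T.2 _ hfx).mem_pruferIdeal_of_smul)

theorem subalgebra_isPruferExtension_iff (hinj : Function.Injective (algebraMap A S))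
    (T : Subalgebra A S) : IsPruferExtension A T ↔ ∀ x ∈ T, IsPruferElement A x := by
  rw [isPruferExtension_iff fun a b hab ↦ hinj (congrArg Subtype.val hab), Subtype.forall]
  exact forall₂_congr fun x hx ↦ (isPruferElement_algHom_iff T.val Subtype.val_injective).symm

theorem isPruferElement_of_mem_pruferHull (hinj : Function.Injective (algebraMap A S))
    {x : S} (hx : x ∈ pruferHull A S) : IsPruferElement A x :=
  isPruferElement_of_mem_sSup (fun T hT ↦ (subalgebra_isPruferExtension_iff hinj T).1 hT) hx

theorem le_pruferHull_iff (hinj : Function.Injective (algebraMap A S)) {T : Subalgebra A S} :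
    T ≤ pruferHull A S ↔ ∀ x ∈ T, IsPruferElement A x :=
  ⟨fun h _ hx ↦ isPruferElement_of_mem_pruferHull hinj (h hx),
    fun h ↦ le_sSup ((subalgebra_isPruferExtension_iff hinj T).2 h)⟩

theorem isGreatest_pruferHull (hinj : Function.Injective (algebraMap A S)) :
    IsGreatest {T : Subalgebra A S | IsPruferExtension A T} (pruferHull A S) :=
  ⟨(subalgebra_isPruferExtension_iff hinj _).2 fun _ ↦ isPruferElement_of_mem_pruferHull hinj,
    fun _ hT ↦ le_sSup hT⟩

/-- Locally at a prime ideal, the fractional ideal generated by `1` and finitely many elements of a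
Prüfer extension is principal. -/
theorem exists_common_denominator_not_mem (m : Ideal A) [m.IsPrime] (I : Finset S)
    (hI : ∀ b ∈ I, ∀ c : A, IsPruferElement A (algebraMap A S c * b)) :
    ∃ c : A, (∀ b ∈ I, ∃ a, algebraMap A S a = algebraMap A S c * b) ∧
      (c ∉ m ∨ ∃ b ∈ I, ∃ a ∉ m, algebraMap A S a = algebraMap A S c * b) := by
  classical
  induction I using Finset.induction_on with
  | empty =>
    exact ⟨1, by simp, .inl fun h ↦ Ideal.IsPrime.ne_top ‹_› ((Ideal.eq_top_iff_one _).2 h)⟩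
  | insert b I _ ih =>
    obtain ⟨c, hc, hcm⟩ := ih fun b' hb' ↦ hI b' (Finset.mem_insert_of_mem hb')
    obtain ⟨u, v, a, e, h1, h2, h3⟩ := hI b (Finset.mem_insert_self b I) c
    have hmul (w a' : A) (hw : algebraMap A S w * (algebraMap A S c * b) = algebraMap A S a') :
        ∀ b' ∈ insert b I, ∃ a, algebraMap A S a = algebraMap A S (w * c) * b' := by
      intro b' hb'
      obtain rfl | hb' := Finset.mem_insert.1 hb'
      · exact ⟨a', by rw [← hw, map_mul, mul_assoc]⟩
      · obtain ⟨a, ha⟩ := hc b' hb'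
        exact ⟨w * a, by rw [map_mul, map_mul, ha, mul_assoc]⟩
    -- As `u + e = 1`, either `u` is a unit at `m` and `c` still serves up to that unit, or `e` is
    -- one and `b` becomes the generator.
    by_cases hu : u ∈ m
    · refine ⟨v * c, hmul v e h2, .inr ⟨b, Finset.mem_insert_self b I, e, fun he ↦ ?_, ?_⟩⟩
      · exact Ideal.IsPrime.ne_top ‹_› ((Ideal.eq_top_iff_one _).2 (h3 ▸ add_mem hu he))
      · rw [← h2, map_mul, mul_assoc]
    · refine ⟨u * c, hmul u a h1, hcm.imp (fun hc h ↦ ?_) ?_⟩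
      · exact (Ideal.IsPrime.mem_or_mem ‹_› h).elim hu hc
      · rintro ⟨b', hb', a', ha', h⟩
        exact ⟨b', Finset.mem_insert_of_mem hb', u * a',
          fun h ↦ (Ideal.IsPrime.mem_or_mem ‹_› h).elim hu ha',
          by rw [map_mul, map_mul, h, mul_assoc]⟩

end

/-! ### The greatest quasi-Prüfer subextension -/

section

variable {R S : Type*} [CommRing R] [CommRing S] [Algebra R S]

/-- If `C` is integrally closed in `S` and `T` is a Prüfer extension of `C ⊓ T`, then every
element integral over `T` satisfies the Prüfer condition over `C`. -/
theorem isPruferElement_of_isIntegral {C T : Subalgebra R S}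
    (hC : ∀ y : S, IsIntegral C y → y ∈ C) (hT : ∀ t ∈ T, IsPruferElement ↥(C ⊓ T) t)
    {x : S} (hx : IsIntegral T x) : IsPruferElement C x := by
  classical
  refine isPruferElement_of_forall_prime fun n hn hle ↦ ?_
  obtain ⟨f, hf, hfx⟩ := hx
  let ι : ↥(C ⊓ T) →+* C := (Subalgebra.inclusion inf_le_left).toRingHom
  -- The polynomial `c * f` has coefficients in `C ⊓ T`, one of them outside `n`: the leading one if
  -- `c` is, as `f` is monic.
  obtain ⟨c, hc, hcn⟩ := exists_common_denominator_not_mem (n.comap ι)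
    (f.coeffs.image (algebraMap T S)) (fun b hb c ↦ by
      obtain ⟨t, -, rfl⟩ := Finset.mem_image.1 hb
      exact hT _ (mul_mem c.2.2 t.2))
  have hcoeff (i : ℕ) : ∃ a : ↥(C ⊓ T), (a : S) = c * f.coeff i := by
    by_cases h0 : f.coeff i = 0
    · exact ⟨0, by simp [h0]⟩
    · exact hc _ (Finset.mem_image_of_mem _ (coeff_mem_coeffs h0))
  have hlift : Polynomial.C (c : S) * f.map (algebraMap T S) ∈ lifts (algebraMap C S) := by
    rw [lifts_iff_coeff_lifts]
    intro i
    obtain ⟨a, ha⟩ := hcoeff i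
    exact ⟨ι a, by rw [coeff_C_mul, coeff_map]; exact ha⟩
  obtain ⟨g, hg⟩ := (mem_lifts _).1 hlift
  have hgc (i : ℕ) : (g.coeff i : S) = c * f.coeff i := by
    have := congrArg (coeff · i) hg
    rwa [coeff_map, coeff_C_mul, coeff_map] at this
  have hgx : aeval x g = 0 := by
    rw [aeval_def, ← eval_map, hg, eval_mul, eval_map, hfx, mul_zero]
  have hgn : ∃ i, g.coeff i ∉ n := by
    obtain hc | ⟨b, hb, a, ha, hab⟩ := hcn
    · refine ⟨f.natDegree, fun h ↦ hc ?_⟩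
      have : g.coeff f.natDegree = ι c := Subtype.ext <| by
        rw [hgc, hf.coeff_natDegree, OneMemClass.coe_one, mul_one]
        rfl
      rwa [this] at h
    · obtain ⟨t, ht, rfl⟩ := Finset.mem_image.1 hb
      obtain ⟨i, -, rfl⟩ := mem_coeffs_iff.1 ht
      refine ⟨i, fun h ↦ ha ?_⟩
      have : g.coeff i = ι a := Subtype.ext <| by
        rw [hgc]
        exact hab.symm
      rwa [this] at h
  obtain ⟨i, hi⟩ := hgn
  exact not_pruferIdeal_le_of_aeval_eq_zero Subtype.val_injective
    (fun y hy ↦ ⟨⟨y, hC y hy⟩, rfl⟩) n _ g le_rfl hgx i hi hle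

/-- Inside `S`, a subextension `T` is quasi-Prüfer if and only if all its elements satisfy the
Prüfer condition over the elements of `T` that are integral over `R`. -/
theorem subalgebra_isQuasiPruferExtension_iff (hinj : Function.Injective (algebraMap R S))
    (T : Subalgebra R S) : IsQuasiPruferExtension R T ↔
      ∀ x ∈ T, IsPruferElement ↥(integralClosure R S ⊓ T) x := by
  have hinjT : Function.Injective (algebraMap R T) :=
    fun a b hab ↦ hinj (congrArg Subtype.val hab)
  rw [IsQuasiPruferExtension, and_iff_right hinjT,
    isPruferExtension_iff Subtype.val_injective, Subtype.forall]
  have hint (a : T) : IsIntegral R (a : S) ↔ IsIntegral R a :=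
    isIntegral_algHom_iff T.val Subtype.val_injective
  let φ : integralClosure R T →ₐ[R] ↥(integralClosure R S ⊓ T) :=
    (T.val.comp (integralClosure R T).val).codRestrict _ fun a ↦ ⟨(hint _).2 a.2, a.1.2⟩
  have hφ : Function.Bijective φ := by
    constructor
    · intro a b hab
      exact Subtype.ext (Subtype.ext (congrArg (fun z : ↥(integralClosure R S ⊓ T) ↦ (z : S)) hab))
    · rintro ⟨a, ha, haT⟩
      exact ⟨⟨⟨a, haT⟩, (hint ⟨a, haT⟩).1 ha⟩, rfl⟩
  exact forall₂_congr fun x hx ↦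
    ⟨fun h ↦ h.map φ.toRingHom T.val.toRingHom fun _ ↦ rfl,
      fun h ↦ .of_map (x := (⟨x, hx⟩ : T)) φ.toRingHom T.val.toRingHom (fun _ ↦ rfl) hφ
        Subtype.val_injective h⟩

theorem mem_integralClosure_of_isIntegral {x : S} (hx : IsIntegral (integralClosure R S) x) :
    x ∈ integralClosure R S :=
  isIntegral_trans x hx

/-- `T` need not contain the integral closure, so it is adjoined; the elements of the resulting ring
are integral over `T`. -/
theorem IsQuasiPruferExtension.le_pruferHull (hinj : Function.Injective (algebraMap R S))
    {T : Subalgebra R S} (hT : IsQuasiPruferExtension R T) :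
    T ≤ (pruferHull (integralClosure R S) S).restrictScalars R := by
  rw [subalgebra_isQuasiPruferExtension_iff hinj] at hT
  have hD : Algebra.adjoin (integralClosure R S) (T : Set S) ≤
      pruferHull (integralClosure R S) S := by
    refine (le_pruferHull_iff Subtype.val_injective).2 fun x hx ↦
      isPruferElement_of_isIntegral (fun y ↦ mem_integralClosure_of_isIntegral) hT ?_
    induction hx using Algebra.adjoin_induction with
    | mem t ht => exact isIntegral_algebraMap (x := (⟨t, ht⟩ : T))
    | algebraMap c => exact IsIntegral.tower_top (R := R) c.2
    | add x y _ _ hx hy => exact hx.add hy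
    | mul x y _ _ hx hy => exact hx.mul hy
  exact fun x hx ↦ hD (Algebra.subset_adjoin hx)

/-- Covers both the greatest quasi-Prüfer subextension and the compositum. -/
theorem isQuasiPruferExtension_of_le (hinj : Function.Injective (algebraMap R S))
    {T : Subalgebra R S} (h₁ : integralClosure R S ≤ T)
    (h₂ : T ≤ (pruferHull (integralClosure R S) S).restrictScalars R) :
    IsQuasiPruferExtension R T := by
  rw [subalgebra_isQuasiPruferExtension_iff hinj]
  intro x hx
  exact (isPruferElement_of_mem_pruferHull Subtype.val_injective (h₂ hx)).map
    (Subalgebra.inclusion (le_inf le_rfl h₁)).toRingHom (RingHom.id S) fun _ ↦ rfl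

theorem integralClosure_le_restrictScalars_pruferHull :
    integralClosure R S ≤ (pruferHull (integralClosure R S) S).restrictScalars R :=
  fun x hx ↦ (pruferHull (integralClosure R S) S).algebraMap_mem ⟨x, hx⟩

theorem isGreatest_restrictScalars_pruferHull (hinj : Function.Injective (algebraMap R S)) :
    IsGreatest {T : Subalgebra R S | IsQuasiPruferExtension R T}
      ((pruferHull (integralClosure R S) S).restrictScalars R) :=
  ⟨isQuasiPruferExtension_of_le hinj integralClosure_le_restrictScalars_pruferHull le_rfl,
    fun _ hT ↦ hT.le_pruferHull hinj⟩

theorem quasiPruferHull_eq (hinj : Function.Injective (algebraMap R S)) :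
    quasiPruferHull R S = (pruferHull (integralClosure R S) S).restrictScalars R :=
  (isGreatest_restrictScalars_pruferHull hinj).isLUB.sSup_eq

theorem pruferHull_le_restrictScalars_pruferHull (hinj : Function.Injective (algebraMap R S)) :
    pruferHull R S ≤ (pruferHull (integralClosure R S) S).restrictScalars R := by
  refine IsQuasiPruferExtension.le_pruferHull hinj ?_
  rw [subalgebra_isQuasiPruferExtension_iff hinj]
  intro x hx
  exact (isPruferElement_of_mem_pruferHull hinj hx).map
    (algebraMap R ↥(integralClosure R S ⊓ pruferHull R S)) (RingHom.id S) fun _ ↦ rfl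

theorem map_integralClosure_eq_of_le {Q : Subalgebra R S} (hQ : integralClosure R S ≤ Q) :
    (integralClosure R Q).map Q.val = integralClosure R S := by
  ext x
  constructor
  · rintro ⟨y, hy, rfl⟩
    exact (isIntegral_algHom_iff Q.val Subtype.val_injective).2 hy
  · intro hx
    exact ⟨⟨x, hQ hx⟩, (isIntegral_algHom_iff Q.val Subtype.val_injective).1 hx, rfl⟩

theorem map_pruferHull_eq_of_le (hinj : Function.Injective (algebraMap R S))
    {Q : Subalgebra R S} (hQ : pruferHull R S ≤ Q) :
    (pruferHull R Q).map Q.val = pruferHull R S := by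
  have hinjQ : Function.Injective (algebraMap R Q) :=
    fun a b hab ↦ hinj (congrArg Subtype.val hab)
  apply le_antisymm
  · rw [le_pruferHull_iff hinj]
    rintro _ ⟨y, hy, rfl⟩
    exact (isPruferElement_algHom_iff Q.val Subtype.val_injective).2
      (isPruferElement_of_mem_pruferHull hinjQ hy)
  · intro x hx
    have : (pruferHull R S).comap Q.val ≤ pruferHull R Q := by
      rw [le_pruferHull_iff hinjQ]
      exact fun y hy ↦ (isPruferElement_algHom_iff Q.val Subtype.val_injective).1
        (isPruferElement_of_mem_pruferHull hinj hy)
    exact ⟨⟨x, hQ hx⟩, this hx, rfl⟩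

end

theorem theorem3p18 (R S : Type*) [CommRing R] [CommRing S] [Algebra R S]
    (hRS : Function.Injective (algebraMap R S)) :
    -- the Prüfer hulls of `R` in `S`, of the integral closure of `R` in `S`, and of `R` in the
    -- quasi-Prüfer hull really are greatest Prüfer subextensions
    (IsGreatest {T : Subalgebra R S | IsPruferExtension R T} (pruferHull R S) ∧
      IsGreatest {T : Subalgebra (integralClosure R S) S |
        IsPruferExtension (integralClosure R S) T} (pruferHull (integralClosure R S) S) ∧
      IsGreatest {T : Subalgebra R (quasiPruferHull R S) | IsPruferExtension R T}
        (pruferHull R (quasiPruferHull R S))) ∧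
    -- greatest quasi-Prüfer subextension
    (IsGreatest {T : Subalgebra R S | IsQuasiPruferExtension R T} (quasiPruferHull R S) ∧
      quasiPruferHull R S = (pruferHull (integralClosure R S) S).restrictScalars R) ∧
    -- the compositum of the integral closure and the Prüfer hull
    (IsQuasiPruferExtension R ↥(integralClosure R S ⊔ pruferHull R S) ∧
      integralClosure R S ⊔ pruferHull R S ≤ quasiPruferHull R S) ∧
    -- integral closure and Prüfer hull inside the greatest quasi-Prüfer subextension
    ((integralClosure R (quasiPruferHull R S)).map (quasiPruferHull R S).val
        = integralClosure R S ∧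
      (pruferHull R (quasiPruferHull R S)).map (quasiPruferHull R S).val
        = pruferHull R S) := by
  have hQ := quasiPruferHull_eq hRS
  have hle : integralClosure R S ⊔ pruferHull R S ≤
      (pruferHull (integralClosure R S) S).restrictScalars R :=
    sup_le integralClosure_le_restrictScalars_pruferHull
      (pruferHull_le_restrictScalars_pruferHull hRS)
  refine ⟨⟨isGreatest_pruferHull hRS, isGreatest_pruferHull Subtype.val_injective,
    isGreatest_pruferHull fun a b hab ↦ hRS (congrArg Subtype.val hab)⟩,
    ⟨hQ ▸ isGreatest_restrictScalars_pruferHull hRS, hQ⟩,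
    ⟨isQuasiPruferExtension_of_le hRS le_sup_left hle, hQ ▸ hle⟩,
    map_integralClosure_eq_of_le ?_, map_pruferHull_eq_of_le hRS ?_⟩
  · exact hQ ▸ integralClosure_le_restrictScalars_pruferHull
  · exact hQ ▸ pruferHull_le_restrictScalars_pruferHull hRS
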